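/- Conventions. An $n$-domain is an open subset of $\mathbb{R}^n$. For diffeological spaces, the D-open subsets are those whose preimage under every plot is open; subsets, products and quotients carry the subspace, product and quotient diffeologies. A map is étale if every point of its source has a D-open neighborhood which it maps diffeomorphically onto a D-open subset of the target. A smooth map $\pi:\mathcal E\to X$ is a diffeological étale map if for every plot $P:U\to X$ ($U$ a domain) the pullback $P^*\pi:\{(r,\xi)\in U\times\mathcal E \mid P(r)=\pi(\xi)\}\to U$, $(r,\xi)\mapsto r$, is étale. A diffeological covering map is a smooth surjection with discrete fibers whose pullbacks by all plots of the base are locally trivial with one common fiber type; its source is a diffeological covering space. An orbifold chart $(U,G,\varphi)$ of a diffeological space $X$ consists of a finite subgroup $G\subseteq \mathrm{GL}(n,\mathbb{R})$, a connected $G$-invariant $n$-domain $U$ (connected sets being nonempty), and a map $\varphi:U\to X$ which is the composite of the quotient map $U\to U/G$ with a diffeomorphism from $U/G$ onto a D-open subspace of $X$. A diffeological $n$-orbifold is a diffeological space in which every point lies in the image of such a chart. **Theorem.** Let $\mathcal O$ be a diffeological $n$-orbifold. 1. Let $\pi:\mathcal E\to\mathcal O$ be a diffeological étale map. Then $\mathcal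 E$ is a diffeological $n$-orbifold. Moreover, let $\xi\in\mathcal E$, let $(U,G,\varphi)$ be an orbifold chart of $\mathcal O$, and let $r_0\in U$ with $\varphi(r_0)=\pi(\xi)$. Then there are an open neighborhood $V\subseteq U$ of $r_0$ and a plot $L:V\to\mathcal E$ with $\pi\circ L=\varphi|_V$ and $L(r_0)=\xi$. For every such pair $(V,L)$ there is an open neighborhood $W\subseteq V$ of $r_0$ which is $G$-stable (that is, $W$ is connected and for each $g\in G$ either $g(W)=W$ or $g(W)\cap W=\varnothing$), such that $G_W:=\{g\in G\mid g(W)=W\}$ equals $G_{r_0}:=\{g\in G\mid g(r_0)=r_0\}$ and $(W,G_W,L|_W)$ is an orbifold chart of $\mathcal E$ (with $\xi=L(r_0)\in L(W)$). 2. If $\pi:\mathcal E\to\mathcal O$ is a diffeological covering map, then $\mathcal E$ is a diffeological $n$-orbifold. -/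

import Mathlib

open scoped Topology ContDiff Pointwise

namespace Diffeology

universe u v w

/-! ### Subspaces, products, quotients -/

/-- The pullback diffeology along `f : X → Y`: `p` is a plot iff `f ∘ p` is a plot of `Y`. -/
@[reducible]
def inducedDiffeology {X : Type u} {Y : Type v} [DiffeologicalSpace Y] (f : X → Y) :
    DiffeologicalSpace X where
  plots _ := {p | IsPlot (f ∘ p)}
  constant_plots _ := isPlot_const
  plot_reparam {_ _ p _} hp hf := isPlot_reparam (p := f ∘ p) hp hf
  locality {_ p} hp := DiffeologicalSpace.locality (p := f ∘ p) hp

/-- The subspace diffeology: the plots are the plots of `X` with values in the subset. -/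
instance instDiffeologicalSpaceSubtype {X : Type u} [DiffeologicalSpace X] (S : X → Prop) :
    DiffeologicalSpace (Subtype S) :=
  inducedDiffeology Subtype.val

/-- The product diffeology: `p` is a plot iff both of its components are plots. -/
instance instDiffeologicalSpaceProd {X : Type u} {Y : Type v}
    [DiffeologicalSpace X] [DiffeologicalSpace Y] : DiffeologicalSpace (X × Y) where
  plots _ := {p | IsPlot (Prod.fst ∘ p) ∧ IsPlot (Prod.snd ∘ p)}
  constant_plots _ := ⟨isPlot_const, isPlot_const⟩
  plot_reparam {_ _ p _} hp hf :=
    ⟨isPlot_reparam (p := Prod.fst ∘ p) hp.1 hf, isPlot_reparam (p := Prod.snd ∘ p) hp.2 hf⟩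
  locality {n p} hp := by
    refine ⟨DiffeologicalSpace.locality (p := Prod.fst ∘ p) fun x ↦ ?_,
      DiffeologicalSpace.locality (p := Prod.snd ∘ p) fun x ↦ ?_⟩
    · obtain ⟨s, hs, hx, h⟩ := hp x
      exact ⟨s, hs, hx, fun hf hf' ↦ (h hf hf').1⟩
    · obtain ⟨s, hs, hx, h⟩ := hp x
      exact ⟨s, hs, hx, fun hf hf' ↦ (h hf hf').2⟩

/-- The quotient diffeology: it is generated by the composites of the plots of `X` with the
quotient map. -/
instance instDiffeologicalSpaceQuotient {X : Type u} [DiffeologicalSpace X] (s : Setoid X) :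
    DiffeologicalSpace (Quotient s) :=
  DiffeologicalSpace.generateFrom
    {P | ∃ (m : ℕ) (p : EuclideanSpace ℝ (Fin m) → X), IsPlot p ∧ P = ⟨m, Quotient.mk s ∘ p⟩}

/-! ### D-open sets, diffeomorphisms, discrete spaces -/

/-- A subset is D-open if it is open in the D-topology. -/
def IsDOpen {X : Type u} [DiffeologicalSpace X] (S : Set X) : Prop :=
  IsOpen[dTopology] S

/-- Diffeomorphisms: bijections that are smooth in both directions. -/
structure DDiffeomorph (X : Type u) (Y : Type v) [DiffeologicalSpace X] [DiffeologicalSpace Y]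
    extends X ≃ Y where
  dSmooth_toFun : DSmooth toFun
  dSmooth_invFun : DSmooth invFun

/-- A diffeological space is discrete if its plots are locally constant. -/
def IsDiscreteDiffeology (X : Type u) [DiffeologicalSpace X] : Prop :=
  ∀ (n : ℕ) (p : EuclideanSpace ℝ (Fin n) → X), IsPlot p → IsLocallyConstant p

/-! ### Étale maps and diffeological étale maps

A plot of `X` with domain an open set `U` of `ℝⁿ` is a smooth map `U → X`, where `U` carries the
subspace diffeology. -/

/-- A map is étale if it restricts, near every point, to a diffeomorphism between D-open
subsets. -/
def IsEtale {X : Type u} {Y : Type v} [DiffeologicalSpace X] [DiffeologicalSpace Y]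
    (f : X → Y) : Prop :=
  ∀ x₀ : X, ∃ (A : Set X) (B : Set Y), IsDOpen A ∧ IsDOpen B ∧ x₀ ∈ A ∧
    ∃ e : DDiffeomorph A B, ∀ x : A, (e.toEquiv x : Y) = f x

/-- The total space `g^*X = {(z, x) | g z = f x} ⊆ Z × X` of the pullback of `f` by `g`, with the
subspace diffeology of the product. -/
abbrev PullbackSpace {X : Type u} {Y : Type v} {Z : Type w} (f : X → Y) (g : Z → Y) :
    Type (max u w) :=
  {q : Z × X // g q.1 = f q.2}

/-- The pullback `g^*f : g^*X → Z` of `f` by `g`. -/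
def pullbackMap {X : Type u} {Y : Type v} {Z : Type w} (f : X → Y) (g : Z → Y) :
    PullbackSpace f g → Z :=
  fun q ↦ q.1.1

/-- A smooth map is a diffeological étale map if its pullback by every plot is étale. -/
def IsDiffEtale {X : Type u} {Y : Type v} [DiffeologicalSpace X] [DiffeologicalSpace Y]
    (f : X → Y) : Prop :=
  DSmooth f ∧ ∀ (m : ℕ) (U : Set (EuclideanSpace ℝ (Fin m))), IsOpen U →
    ∀ P : U → Y, DSmooth P → IsEtale (pullbackMap f P)

/-! ### Fiber bundles and covering maps -/

/-- `f : X → Y` is locally trivial with fiber `T`: around every point of `Y` there is a D-open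
set `B` with `f ⁻¹(B)` diffeomorphic to `B × T` over `B`. -/
def IsLocallyTrivial (T : Type w) [DiffeologicalSpace T] {X : Type u} {Y : Type v}
    [DiffeologicalSpace X] [DiffeologicalSpace Y] (f : X → Y) : Prop :=
  ∀ y₀ : Y, ∃ B : Set Y, IsDOpen B ∧ y₀ ∈ B ∧
    ∃ e : DDiffeomorph (B × T) (f ⁻¹' B), ∀ z : B × T, f (e.toEquiv z) = z.1

/-- A diffeological fiber bundle of fiber type `T`: a smooth surjection whose pullback by every
plot of the base is locally trivial with fiber `T`. -/
def IsDiffFiberBundle (T : Type w) [DiffeologicalSpace T] {X : Type u} {Y : Type v}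
    [DiffeologicalSpace X] [DiffeologicalSpace Y] (f : X → Y) : Prop :=
  DSmooth f ∧ Function.Surjective f ∧
    ∀ (m : ℕ) (U : Set (EuclideanSpace ℝ (Fin m))), IsOpen U →
      ∀ P : U → Y, DSmooth P → IsLocallyTrivial T (pullbackMap f P)

/-- A diffeological covering map: a diffeological fiber bundle with discrete fibers. (If `Y` is
nonempty, the fiber type is diffeomorphic to a fiber of `f`, so the universe of `X` suffices
for it.) -/
def IsDiffCovering {X : Type u} {Y : Type v} [DiffeologicalSpace X] [DiffeologicalSpace Y]
    (f : X → Y) : Prop :=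
  (∃ (T : Type u) (_ : DiffeologicalSpace T), IsDiffFiberBundle T f) ∧
    ∀ y : Y, IsDiscreteDiffeology (f ⁻¹' {y})

/-! ### Orbifolds -/

/-- The general linear group of `ℝⁿ`, acting on `ℝⁿ` by evaluation. -/
abbrev GLn (n : ℕ) : Type := LinearMap.GeneralLinearGroup ℝ (EuclideanSpace ℝ (Fin n))

/-- Two points of `U` are related iff they lie in the same `G`-orbit. For `G`-invariant `U` the
quotient of `U` by this relation is `U / G`. -/
def orbitSetoid {n : ℕ} (U : Set (EuclideanSpace ℝ (Fin n))) (G : Subgroup (GLn n)) : Setoid U :=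
  (MulAction.orbitRel G (EuclideanSpace ℝ (Fin n))).comap Subtype.val

/-- `(U, G, φ)` is an orbifold chart of `X`: `G` is a finite subgroup of `GL(n, ℝ)`, `U` is a
connected `G`-invariant open subset of `ℝⁿ`, and `φ : U → X` is the composite of the quotient map
`U → U / G` and a diffeomorphism from `U / G` onto a D-open subspace `S` of `X`. -/
structure IsOrbifoldChart {n : ℕ} {X : Type u} [DiffeologicalSpace X]
    (U : Set (EuclideanSpace ℝ (Fin n))) (G : Subgroup (GLn n)) (φ : U → X) : Prop where
  isOpen : IsOpen U
  isConnected : IsConnected U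
  finite : Finite G
  invariant : ∀ g ∈ G, ∀ r ∈ U, g • r ∈ U
  exists_diffeomorph : ∃ S : Set X, IsDOpen S ∧
    ∃ e : DDiffeomorph (Quotient (orbitSetoid U G)) S,
      ∀ r : U, φ r = e.toEquiv (Quotient.mk (orbitSetoid U G) r)

/-- A diffeological `n`-orbifold: every point has a D-open neighborhood that is diffeomorphic to
some `U / G`, that is, every point lies in the image of an orbifold chart. -/
def IsDiffOrbifold (n : ℕ) (X : Type u) [DiffeologicalSpace X] : Prop :=
  ∀ x : X, ∃ (U : Set (EuclideanSpace ℝ (Fin n))) (G : Subgroup (GLn n)) (φ : U → X),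
    IsOrbifoldChart U G φ ∧ x ∈ Set.range φ

/-- `W` is `G`-stable: it is connected and every `g ∈ G` either preserves `W` or moves it off
itself. -/
def IsStableUnder {n : ℕ} (G : Subgroup (GLn n)) (W : Set (EuclideanSpace ℝ (Fin n))) : Prop :=
  IsConnected W ∧ ∀ g ∈ G, g • W = W ∨ Disjoint (g • W) W

/-- The subgroup `G_W = {g ∈ G | g(W) = W}`. -/
def setStabilizer {n : ℕ} (G : Subgroup (GLn n)) (W : Set (EuclideanSpace ℝ (Fin n))) :
    Subgroup (GLn n) :=
  G ⊓ MulAction.stabilizer (GLn n) W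

/-- The isotropy subgroup `G_r = {g ∈ G | g(r) = r}`. -/
def isotropy {n : ℕ} (G : Subgroup (GLn n)) (r : EuclideanSpace ℝ (Fin n)) : Subgroup (GLn n) :=
  G ⊓ MulAction.stabilizer (GLn n) r

/-- `L`, defined on `V`, is a local lift at `r₀` through `ξ` of `φ : U → Y` along `f : X → Y`:
`V` is an open neighborhood of `r₀` in `U`, and `L` is a plot with `f ∘ L = φ|_V` and
`L(r₀) = ξ`. -/
structure IsLocalLift {m : ℕ} {X : Type u} {Y : Type v} [DiffeologicalSpace X]
    (f : X → Y) {U : Set (EuclideanSpace ℝ (Fin m))} (φ : U → Y) (r₀ : U) (ξ : X)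
    (V : Set (EuclideanSpace ℝ (Fin m))) (L : V → X) : Prop where
  isOpen : IsOpen V
  subset : V ⊆ U
  dSmooth : DSmooth L
  lift : ∀ r : V, f (L r) = φ ⟨r, subset r.2⟩
  base : ∃ h : (r₀ : EuclideanSpace ℝ (Fin m)) ∈ V, L ⟨r₀, h⟩ = ξ

end Diffeology

open Diffeology

/-!
Along a diffeological étale map `π`, two plots whose composites with `π` have the same germ at a
point agree near that point as soon as they agree at it: pulled back along the common composite they
become sections of an étale map. An orbifold chart `φ` is the same thing as a local subduction
(plots lift locally through any prescribed point of the fiber) whose fibers are the orbits of the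
group. If `π ∘ L = φ`, germ uniqueness makes `L` a local subduction too; it also shows that `L` is
invariant near `r₀` under the isotropy group of `r₀`, since `L` and `L ∘ g` lift the same plot and
agree at `r₀`. On a small stable neighborhood of `r₀` the fibers of `L` are therefore the orbits of
the isotropy group. Finally, a covering map is a diffeological étale map because a product with a
discrete fiber is étale over its base.
-/

namespace EtaleOrbifold

variable {X Y Z : Type*} [DiffeologicalSpace X] [DiffeologicalSpace Y] [DiffeologicalSpace Z]

section Germs

-- Plots are defined on all of `ℝᵐ`; precomposing with such a `ρ` replaces a plot by one with the
-- same germ and with all its values in a given D-open set.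
theorem exists_contDiff_eventuallyEq_id {E : Type*} [NormedAddCommGroup E] [NormedSpace ℝ E]
    [HasContDiffBump E] {x : E} {N : Set E} (hN : N ∈ 𝓝 x) :
    ∃ ρ : E → E, ContDiff ℝ ∞ ρ ∧ (∀ y, ρ y ∈ N) ∧ ρ =ᶠ[𝓝 x] id := by
  obtain ⟨ε, hε, hball⟩ := Metric.mem_nhds_iff.1 hN
  let χ : ContDiffBump x := ⟨ε / 2, ε, half_pos hε, half_lt_self hε⟩
  refine ⟨fun y ↦ x + χ y • (y - x), ?_, fun y ↦ hball ?_, ?_⟩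
  · exact contDiff_const.add (χ.contDiff.smul (contDiff_id.sub contDiff_const))
  · rw [mem_ball_iff_norm, add_sub_cancel_left, norm_smul, Real.norm_of_nonneg χ.nonneg]
    rcases lt_or_ge ‖y - x‖ ε with hy | hy
    · exact (mul_le_of_le_one_left (norm_nonneg _) χ.le_one).trans_lt hy
    · rw [χ.zero_of_le_dist (by rwa [dist_eq_norm]), zero_mul]
      exact hε
  · filter_upwards [χ.eventuallyEq_one] with y hy
    simp [hy]

theorem isPlot_of_eventuallyEq {m : ℕ} {p : EuclideanSpace ℝ (Fin m) → X}
    (h : ∀ x, ∃ q : EuclideanSpace ℝ (Fin m) → X, IsPlot q ∧ p =ᶠ[𝓝 x] q) : IsPlot p := by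
  refine DiffeologicalSpace.locality fun x ↦ ?_
  obtain ⟨q, hq, hpq⟩ := h x
  obtain ⟨u, hu, hu_open, hx⟩ := mem_nhds_iff.1 hpq
  refine ⟨u, hu_open, hx, fun {k f} hfu hf ↦ ?_⟩
  have hcomp : p ∘ f = q ∘ f := funext fun y ↦ hu (hfu y)
  rw [hcomp]
  exact isPlot_reparam hq hf

end Germs

section Basic

theorem dSmooth_subtypeVal (S : Set X) : DSmooth (Subtype.val : S → X) := fun _ _ hp ↦ hp

theorem dSmooth_codRestrict {f : X → Y} (hf : DSmooth f) {S : Set Y} (h : ∀ x, f x ∈ S) :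
    DSmooth (S.codRestrict f h) := hf

theorem dSmooth_inclusion {S T : Set X} (h : S ⊆ T) : DSmooth (Set.inclusion h) :=
  fun _ _ hp ↦ hp

theorem dSmooth_prodMk {f : X → Y} {g : X → Z} (hf : DSmooth f) (hg : DSmooth g) :
    DSmooth fun x ↦ (f x, g x) := fun _ p hp ↦ ⟨hf _ p hp, hg _ p hp⟩

theorem dSmooth_fst : DSmooth (Prod.fst : X × Y → X) := fun _ _ hp ↦ hp.1

theorem dSmooth_snd : DSmooth (Prod.snd : X × Y → Y) := fun _ _ hp ↦ hp.2

theorem isDOpen_preimage {f : X → Y} (hf : DSmooth f) {S : Set Y} (hS : IsDOpen S) :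
    IsDOpen (f ⁻¹' S) :=
  @IsOpen.preimage _ _ dTopology dTopology f hf.continuous S hS

end Basic

section LocalSubduction

/-- Local subductions: smooth maps `f : X → Y` along which every plot of `Y` lifts, near any point
of its domain, through any prescribed point of the corresponding fiber. In contrast to the usual
notion, `f` need not be surjective. -/
structure IsLocalSubduction (f : X → Y) : Prop where
  dSmooth : DSmooth f
  exists_lift : ∀ ⦃m : ℕ⦄ (p : EuclideanSpace ℝ (Fin m) → Y), IsPlot p → ∀ x a, f a = p x →
    ∃ q : EuclideanSpace ℝ (Fin m) → X, IsPlot q ∧ q x = a ∧ f ∘ q =ᶠ[𝓝 x] p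

namespace IsLocalSubduction

theorem comp {g : Y → Z} {f : X → Y} (hg : IsLocalSubduction g) (hf : IsLocalSubduction f) :
    IsLocalSubduction (g ∘ f) where
  dSmooth := hg.dSmooth.comp hf.dSmooth
  exists_lift := fun m p hp x a ha ↦ by
    obtain ⟨q, hq, hqx, hgq⟩ := hg.exists_lift p hp x (f a) ha
    obtain ⟨r, hr, hrx, hfr⟩ := hf.exists_lift q hq x a hqx.symm
    exact ⟨r, hr, hrx, (hfr.fun_comp g).trans hgq⟩

theorem isDOpen_image {f : X → Y} (hf : IsLocalSubduction f) {A : Set X} (hA : IsDOpen A) :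
    IsDOpen (f '' A) := by
  refine isOpen_iff_preimages_plots.2 fun m p hp ↦ isOpen_iff_mem_nhds.2 fun x ⟨a, ha, hax⟩ ↦ ?_
  obtain ⟨q, hq, hqx, hfq⟩ := hf.exists_lift p hp x a hax
  have hqA : q ⁻¹' A ∈ 𝓝 x :=
    (isOpen_iff_preimages_plots.1 hA m q hq).mem_nhds (by rwa [Set.mem_preimage, hqx])
  filter_upwards [hqA, hfq] with y hyA hy
  exact ⟨q y, hyA, hy⟩

theorem isDOpen_range {f : X → Y} (hf : IsLocalSubduction f) : IsDOpen (Set.range f) := by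
  rw [← Set.image_univ]
  exact hf.isDOpen_image (@isOpen_univ _ dTopology)

end IsLocalSubduction

theorem isLocalSubduction_subtypeVal {S : Set X} (hS : IsDOpen S) :
    IsLocalSubduction (Subtype.val : S → X) where
  dSmooth := dSmooth_subtypeVal S
  exists_lift := by
    rintro m p hp x a ha
    have hpS : p ⁻¹' S ∈ 𝓝 x :=
      (isOpen_iff_preimages_plots.1 hS m p hp).mem_nhds (by simp [← ha])
    obtain ⟨ρ, hρ, hρS, hρx⟩ := exists_contDiff_eventuallyEq_id hpS
    refine ⟨fun y ↦ ⟨p (ρ y), hρS y⟩, isPlot_reparam hp hρ, Subtype.ext ?_, hρx.fun_comp p⟩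
    exact (congrArg p hρx.eq_of_nhds).trans ha.symm

theorem isLocalSubduction_inclusion {S T : Set X} (hS : IsDOpen S) (h : S ⊆ T) :
    IsLocalSubduction (Set.inclusion h) where
  dSmooth := dSmooth_inclusion h
  exists_lift := fun m p hp x a ha ↦ by
    obtain ⟨q, hq, hqx, hpq⟩ := (isLocalSubduction_subtypeVal hS).exists_lift (Subtype.val ∘ p)
      hp x a (congrArg Subtype.val ha)
    exact ⟨q, hq, hqx, hpq.mono fun y hy ↦ Subtype.ext hy⟩

theorem isLocalSubduction_of_forall_exists {f : X → Y}
    (h : ∀ a, ∃ A : Set X, IsDOpen A ∧ a ∈ A ∧ IsLocalSubduction (f ∘ (Subtype.val : A → X))) :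
    IsLocalSubduction f where
  dSmooth := fun m p hp ↦ isPlot_of_eventuallyEq fun x ↦ by
    obtain ⟨A, hA, hxA, hfA⟩ := h (p x)
    obtain ⟨q, hq, -, hqp⟩ :=
      (isLocalSubduction_subtypeVal hA).exists_lift p hp x ⟨p x, hxA⟩ rfl
    exact ⟨_, hq.dSmooth_comp hfA.dSmooth, (hqp.fun_comp f).symm⟩
  exists_lift := fun m p hp x a ha ↦ by
    obtain ⟨A, -, haA, hfA⟩ := h a
    obtain ⟨q, hq, hqx, hqp⟩ := hfA.exists_lift p hp x ⟨a, haA⟩ ha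
    exact ⟨Subtype.val ∘ q, hq.dSmooth_comp (dSmooth_subtypeVal A), congrArg Subtype.val hqx, hqp⟩

theorem isLocalSubduction_dDiffeomorph (e : DDiffeomorph X Y) :
    IsLocalSubduction e.toEquiv where
  dSmooth := e.dSmooth_toFun
  exists_lift := fun _ p hp _ _ ha ↦
    ⟨e.toEquiv.symm ∘ p, hp.dSmooth_comp e.dSmooth_invFun, e.toEquiv.symm_apply_eq.2 ha.symm,
      .of_forall fun y ↦ e.toEquiv.apply_symm_apply (p y)⟩

end LocalSubduction

section Quotient

variable {s : Setoid X}

theorem dSmooth_quotientMk : DSmooth (Quotient.mk s) := fun m p hp ↦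
  DiffeologicalSpace.isPlot_generatedFrom_of_mem ⟨m, p, hp, rfl⟩

theorem quotientDiffeology_le {d : DiffeologicalSpace (Quotient s)}
    (h : @DSmooth _ _ _ d (Quotient.mk s)) : instDiffeologicalSpaceQuotient s ≤ d := by
  refine DiffeologicalSpace.generateFrom_le_iff.2 ?_
  rintro m _ ⟨_, p, hp, ⟨⟩⟩
  exact h m p hp

theorem dSmooth_of_comp_quotientMk {f : Quotient s → Y} (hf : DSmooth (f ∘ Quotient.mk s)) :
    DSmooth f :=
  DiffeologicalSpace.le_iff'.1 (quotientDiffeology_le (d := inducedDiffeology f) hf)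

variable (s) in
/-- The diffeology on `X / s` whose plots are the maps that lift locally to plots of `X`. It agrees
with the quotient diffeology, which is what makes the latter accessible. -/
@[reducible]
def locallyLiftableDiffeology : DiffeologicalSpace (Quotient s) where
  plots m := {p | ∀ x, ∃ q : EuclideanSpace ℝ (Fin m) → X, IsPlot q ∧ Quotient.mk s ∘ q =ᶠ[𝓝 x] p}
  constant_plots a := fun _ ↦ ⟨fun _ ↦ a.out, isPlot_const, .of_forall fun _ ↦ a.out_eq⟩
  plot_reparam {_ _ p f} hp hf := fun x ↦ by
    obtain ⟨q, hq, hqp⟩ := hp (f x)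
    exact ⟨q ∘ f, isPlot_reparam hq hf, hf.continuous.continuousAt.eventually hqp⟩
  locality {m p} hp := fun x ↦ by
    obtain ⟨u, hu, hxu, h⟩ := hp x
    obtain ⟨ρ, hρ, hρu, hρx⟩ := exists_contDiff_eventuallyEq_id (hu.mem_nhds hxu)
    obtain ⟨q, hq, hqp⟩ := h hρu hρ x
    exact ⟨q, hq, hqp.trans (hρx.fun_comp p)⟩

theorem exists_isPlot_lift_quotient {m : ℕ} {p : EuclideanSpace ℝ (Fin m) → Quotient s}
    (hp : IsPlot p) (x : EuclideanSpace ℝ (Fin m)) :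
    ∃ q : EuclideanSpace ℝ (Fin m) → X, IsPlot q ∧ Quotient.mk s ∘ q =ᶠ[𝓝 x] p :=
  DiffeologicalSpace.le_iff'.1 (quotientDiffeology_le (d := locallyLiftableDiffeology s)
    fun _ q hq _ ↦ ⟨q, hq, .rfl⟩) m p hp x

theorem isLocalSubduction_quotientMk
    (h : ∀ a b, s a b → ∃ g : X → X, DSmooth g ∧ g a = b ∧ ∀ c, s (g c) c) :
    IsLocalSubduction (Quotient.mk s) where
  dSmooth := dSmooth_quotientMk
  exists_lift := fun m p hp x a ha ↦ by
    obtain ⟨q, hq, hqp⟩ := exists_isPlot_lift_quotient hp x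
    have hqa : s (q x) a := Quotient.exact (hqp.eq_of_nhds.trans ha.symm)
    obtain ⟨g, hg, hga, hgs⟩ := h _ _ hqa
    have hmk : Quotient.mk s ∘ g = Quotient.mk s := funext fun c ↦ Quotient.sound (hgs c)
    refine ⟨g ∘ q, hq.dSmooth_comp hg, hga, ?_⟩
    rwa [← Function.comp_assoc, hmk]

/-- A local subduction identifies the quotient by its kernel with its range. -/
noncomputable def IsLocalSubduction.quotientKerDiffeomorph {f : X → Y} (hf : IsLocalSubduction f) :
    DDiffeomorph (Quotient (Setoid.ker f)) (Set.range f) where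
  toEquiv := Setoid.quotientKerEquivRange f
  dSmooth_toFun := dSmooth_of_comp_quotientMk (dSmooth_codRestrict hf.dSmooth Set.mem_range_self)
  dSmooth_invFun := fun m p hp ↦ isPlot_of_eventuallyEq fun x ↦ by
    obtain ⟨a, ha⟩ := (p x).2
    obtain ⟨q, hq, -, hqp⟩ := hf.exists_lift (Subtype.val ∘ p) hp x a ha
    refine ⟨Quotient.mk _ ∘ q, hq.dSmooth_comp dSmooth_quotientMk, hqp.mono fun y hy ↦ ?_⟩
    exact (Equiv.symm_apply_eq _).2 (Subtype.ext hy.symm)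

end Quotient

section Discrete

theorem isDiscreteDiffeology_of_injective {f : X → Y} (hf : DSmooth f)
    (hinj : Function.Injective f) (hY : IsDiscreteDiffeology Y) : IsDiscreteDiffeology X :=
  fun m p hp ↦ (hY m (f ∘ p) (hp.dSmooth_comp hf)).desc p f hinj

end Discrete

section Pullback

variable {X Y Z : Type*} [DiffeologicalSpace X] [DiffeologicalSpace Z]

theorem isPlot_pullbackSpaceMk {f : X → Y} {g : Z → Y} {m : ℕ} {r : EuclideanSpace ℝ (Fin m) → Z}
    {p : EuclideanSpace ℝ (Fin m) → X} (hr : IsPlot r) (hp : IsPlot p)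
    (h : ∀ y, g (r y) = f (p y)) : IsPlot fun y ↦ (⟨(r y, p y), h y⟩ : PullbackSpace f g) :=
  ⟨hr, hp⟩

theorem dSmooth_pullbackMap (f : X → Y) (g : Z → Y) : DSmooth (pullbackMap f g) :=
  dSmooth_fst.comp (dSmooth_subtypeVal _)

theorem dSmooth_pullbackSpace_snd (f : X → Y) (g : Z → Y) :
    DSmooth fun z : PullbackSpace f g ↦ z.1.2 :=
  dSmooth_snd.comp (dSmooth_subtypeVal _)

theorem isDiscreteDiffeology_fiber_pullbackMap {f : X → Y} {g : Z → Y} (z : Z)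
    (h : IsDiscreteDiffeology (f ⁻¹' {g z})) : IsDiscreteDiffeology (pullbackMap f g ⁻¹' {z}) := by
  have hmem : ∀ w : pullbackMap f g ⁻¹' {z}, f w.1.1.2 = g z := fun w ↦
    w.1.2.symm.trans (congrArg g w.2)
  refine isDiscreteDiffeology_of_injective (dSmooth_codRestrict
    ((dSmooth_pullbackSpace_snd f g).comp (dSmooth_subtypeVal _)) hmem) (fun w w' hw ↦ ?_) h
  exact Subtype.ext (Subtype.ext (Prod.ext (w.2.trans w'.2.symm) (congrArg Subtype.val hw)))

end Pullback

section Etale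

theorem isLocalSubduction_of_isEtale {f : X → Y} (hf : IsEtale f) : IsLocalSubduction f := by
  refine isLocalSubduction_of_forall_exists fun a ↦ ?_
  obtain ⟨A, B, hA, hB, haA, e, he⟩ := hf a
  have hfe : f ∘ (Subtype.val : A → X) = Subtype.val ∘ e.toEquiv := funext fun x ↦ (he x).symm
  refine ⟨A, hA, haA, ?_⟩
  rw [hfe]
  exact (isLocalSubduction_subtypeVal hB).comp (isLocalSubduction_dDiffeomorph e)

theorem eventuallyEq_of_isEtale {f : X → Y} (hf : IsEtale f) {m : ℕ}
    {p q : EuclideanSpace ℝ (Fin m) → X} (hp : IsPlot p) (hq : IsPlot q)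
    {x : EuclideanSpace ℝ (Fin m)} (hpq : f ∘ p =ᶠ[𝓝 x] f ∘ q) (hx : p x = q x) : p =ᶠ[𝓝 x] q := by
  obtain ⟨A, B, hA, -, hxA, e, he⟩ := hf (p x)
  have hpA : p ⁻¹' A ∈ 𝓝 x := (isOpen_iff_preimages_plots.1 hA m p hp).mem_nhds hxA
  have hqA : q ⁻¹' A ∈ 𝓝 x :=
    (isOpen_iff_preimages_plots.1 hA m q hq).mem_nhds (by rwa [Set.mem_preimage, ← hx])
  filter_upwards [hpA, hqA, hpq] with y hpy hqy hy
  have hey : e.toEquiv ⟨p y, hpy⟩ = e.toEquiv ⟨q y, hqy⟩ := by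
    rw [← SetCoe.ext_iff, he, he]
    exact hy
  exact congrArg Subtype.val (e.toEquiv.injective hey)

theorem eventuallyEq_of_isDiffEtale {f : X → Y} (hf : IsDiffEtale f) {m : ℕ}
    {p q : EuclideanSpace ℝ (Fin m) → X} (hp : IsPlot p) (hq : IsPlot q)
    {x : EuclideanSpace ℝ (Fin m)} (hpq : f ∘ p =ᶠ[𝓝 x] f ∘ q) (hx : p x = q x) : p =ᶠ[𝓝 x] q := by
  obtain ⟨ρ, hρ, hρpq, hρx⟩ := exists_contDiff_eventuallyEq_id hpq
  let P : ↥(Set.univ : Set (EuclideanSpace ℝ (Fin m))) → Y := fun y ↦ f (p (ρ y))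
  have hP : DSmooth P :=
    (hf.1.comp (isPlot_reparam hp hρ).dSmooth).comp (dSmooth_subtypeVal _)
  let ι (y : EuclideanSpace ℝ (Fin m)) : ↥(Set.univ : Set (EuclideanSpace ℝ (Fin m))) :=
    ⟨y, trivial⟩
  have hι : IsPlot ι := contDiff_id.isPlot
  have hsec := eventuallyEq_of_isEtale (hf.2 m _ isOpen_univ P hP) (x := x)
    (isPlot_pullbackSpaceMk hι (isPlot_reparam hp hρ) fun _ ↦ rfl)
    (isPlot_pullbackSpaceMk (g := P) hι (isPlot_reparam hq hρ) hρpq) .rfl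
    (Subtype.ext (Prod.ext rfl (by simp [hρx.eq_of_nhds, hx])))
  filter_upwards [hsec, hρx] with y hy hρy
  simpa [hρy] using congrArg (fun z ↦ z.1.2) hy

theorem isLocalSubduction_of_comp {f : X → Y} (hf : IsDiffEtale f) {g : Z → X} (hg : DSmooth g)
    (hfg : IsLocalSubduction (f ∘ g)) : IsLocalSubduction g where
  dSmooth := hg
  exists_lift := fun m p hp x a ha ↦ by
    obtain ⟨q, hq, hqx, hqp⟩ :=
      hfg.exists_lift (f ∘ p) (hp.dSmooth_comp hf.1) x a (congrArg f ha)
    refine ⟨q, hq, hqx, eventuallyEq_of_isDiffEtale hf (hq.dSmooth_comp hg) hp hqp ?_⟩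
    rw [Function.comp_apply, hqx, ha]

theorem exists_isLocalLift {f : X → Y} (hf : IsDiffEtale f) {m : ℕ}
    {U : Set (EuclideanSpace ℝ (Fin m))} (hU : IsOpen U) {φ : U → Y} (hφ : DSmooth φ) {r₀ : U}
    {ξ : X} (h : φ r₀ = f ξ) :
    ∃ (V : Set (EuclideanSpace ℝ (Fin m))) (L : V → X), IsLocalLift f φ r₀ ξ V L := by
  have hsub := (isLocalSubduction_subtypeVal hU).comp
    (isLocalSubduction_of_isEtale (hf.2 m U hU φ hφ))
  obtain ⟨q, hq, hqr₀, hqid⟩ := hsub.exists_lift id contDiff_id.isPlot r₀ ⟨(r₀, ξ), h⟩ rfl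
  obtain ⟨V, hV, hVopen, hr₀V⟩ := mem_nhds_iff.1 hqid
  have hqV : ∀ r ∈ V, ∃ hrU : r ∈ U, (q r).1.1 = ⟨r, hrU⟩ := fun r hr ↦
    have hqr : ((q r).1.1 : EuclideanSpace ℝ (Fin m)) = r := hV hr
    ⟨hqr ▸ (q r).1.1.2, Subtype.ext hqr⟩
  refine ⟨V, fun r ↦ (q r).1.2, hVopen, fun r hr ↦ (hqV r hr).1, ?_, fun r ↦ ?_, hr₀V, ?_⟩
  · exact (dSmooth_pullbackSpace_snd f φ).comp (hq.dSmooth.comp (dSmooth_subtypeVal V))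
  · rw [← (q r).2, (hqV r r.2).2]
  · rw [hqr₀]

end Etale

section Covering

variable {T : Type*} [DiffeologicalSpace T]

theorem isDiscreteDiffeology_of_isLocallyTrivial {f : X → Y} (hf : IsLocallyTrivial T f) (y : Y)
    (hy : IsDiscreteDiffeology (f ⁻¹' {y})) : IsDiscreteDiffeology T := by
  obtain ⟨B, -, hyB, e, he⟩ := hf y
  let slice : T → X := fun t ↦ e.toEquiv (⟨y, hyB⟩, t)
  have hslice : DSmooth slice :=
    (dSmooth_subtypeVal _).comp (e.dSmooth_toFun.comp (dSmooth_prodMk dSmooth_const dSmooth_id))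
  have hinj : Function.Injective slice := fun t t' ht ↦
    congrArg Prod.snd (e.toEquiv.injective (Subtype.ext ht))
  have hfiber : ∀ t, slice t ∈ f ⁻¹' {y} := fun t ↦ he (⟨y, hyB⟩, t)
  exact isDiscreteDiffeology_of_injective (dSmooth_codRestrict hslice hfiber)
    (hinj.codRestrict hfiber) hy

theorem isLocalSubduction_prodMk_right (hT : IsDiscreteDiffeology T) (t : T) :
    IsLocalSubduction fun x : X ↦ (x, t) where
  dSmooth := dSmooth_prodMk dSmooth_id dSmooth_const
  exists_lift := fun m p hp x a ha ↦ by
    have hsnd : ∀ᶠ y in 𝓝 x, (p y).2 = (p x).2 :=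
      (IsLocallyConstant.iff_eventually_eq _).1 (hT m _ (hp.dSmooth_comp dSmooth_snd)) x
    refine ⟨Prod.fst ∘ p, hp.dSmooth_comp dSmooth_fst, congrArg Prod.fst ha.symm, ?_⟩
    filter_upwards [hsnd] with y hy
    exact Prod.ext rfl ((congrArg Prod.snd ha).trans hy.symm)

theorem isEtale_of_isLocallyTrivial (hT : IsDiscreteDiffeology T) {f : X → Y} (hf : DSmooth f)
    (htriv : IsLocallyTrivial T f) : IsEtale f := by
  intro x
  obtain ⟨B, hB, hxB, e, he⟩ := htriv (f x)
  let t := (e.toEquiv.symm ⟨x, hxB⟩).2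
  let sheet : B → X := fun b ↦ e.toEquiv (b, t)
  have hfsheet : ∀ b, f (sheet b) = b := fun b ↦ he (b, t)
  have hsheet : IsLocalSubduction sheet :=
    ((isLocalSubduction_subtypeVal (isDOpen_preimage hf hB)).comp
      (isLocalSubduction_dDiffeomorph e)).comp (isLocalSubduction_prodMk_right hT t)
  have hmem : ∀ a : Set.range sheet, f a ∈ B := by
    rintro ⟨_, b, rfl⟩
    exact hfsheet b ▸ b.2
  refine ⟨Set.range sheet, B, hsheet.isDOpen_range, hB, ⟨(e.toEquiv.symm ⟨x, hxB⟩).1, ?_⟩, ⟨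
    { toFun := fun a ↦ ⟨f a, hmem a⟩
      invFun := fun b ↦ ⟨sheet b, b, rfl⟩
      left_inv := ?_
      right_inv := fun b ↦ Subtype.ext (hfsheet b) }, ?_, ?_⟩, fun _ ↦ rfl⟩
  · exact congrArg Subtype.val (e.toEquiv.apply_symm_apply ⟨x, hxB⟩)
  · rintro ⟨_, b, rfl⟩
    exact Subtype.ext (congrArg sheet (Subtype.ext (hfsheet b)))
  · exact dSmooth_codRestrict (hf.comp (dSmooth_subtypeVal _)) hmem
  · exact dSmooth_codRestrict hsheet.dSmooth _

theorem isDiffEtale_of_isDiffCovering {f : X → Y} (hf : IsDiffCovering f) : IsDiffEtale f := by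
  obtain ⟨⟨T, _, hsmooth, -, htriv⟩, hdisc⟩ := hf
  refine ⟨hsmooth, fun m U hU P hP z ↦ ?_⟩
  have hP_triv := htriv m U hU P hP
  have hT : IsDiscreteDiffeology T := isDiscreteDiffeology_of_isLocallyTrivial hP_triv _
    (isDiscreteDiffeology_fiber_pullbackMap z.1.1 (hdisc _))
  exact isEtale_of_isLocallyTrivial hT (dSmooth_pullbackMap f P) hP_triv z

end Covering

section StableNeighborhood

theorem exists_isOpen_convex_smul_eq {H E : Type*} [Group H] [Finite H] [AddCommGroup E]
    [Module ℝ E] [TopologicalSpace E] [IsTopologicalAddGroup E] [ContinuousConstSMul ℝ E]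
    [LocallyConvexSpace ℝ E] [DistribMulAction H E] [SMulCommClass H ℝ E] [ContinuousConstSMul H E]
    {x : E} (hx : ∀ h : H, h • x = x) {N : Set E} (hN : N ∈ 𝓝 x) :
    ∃ W ⊆ N, x ∈ W ∧ IsOpen W ∧ Convex ℝ W ∧ ∀ h : H, h • W = W := by
  obtain ⟨C, ⟨hCx, hC⟩, hCN⟩ := (LocallyConvexSpace.convex_basis (𝕜 := ℝ) x).mem_iff.1 hN
  refine ⟨⋂ h : H, h • interior C, ?_, ?_, ?_, ?_, fun g ↦ ?_⟩
  · refine (Set.iInter_subset _ 1).trans ?_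
    rw [one_smul]
    exact interior_subset.trans hCN
  · exact Set.mem_iInter.2 fun h ↦ ⟨x, mem_interior_iff_mem_nhds.2 hCx, hx h⟩
  · exact isOpen_iInter_of_finite fun h ↦ isOpen_interior.smul h
  · exact convex_iInter fun h ↦ hC.interior.linear_image (DistribSMul.toLinearMap ℝ E h)
  · simp only [Set.smul_set_iInter, smul_smul]
    exact (Equiv.mulLeft g).surjective.iInter_comp fun h ↦ h • interior C

theorem contDiff_generalLinearGroup_smul {E : Type*} [NormedAddCommGroup E] [NormedSpace ℝ E]
    [FiniteDimensional ℝ E] (g : LinearMap.GeneralLinearGroup ℝ E) :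
    ContDiff ℝ ∞ fun r : E ↦ g • r :=
  (LinearMap.toContinuousLinearMap (g : E →ₗ[ℝ] E)).contDiff

instance {E : Type*} [NormedAddCommGroup E] [NormedSpace ℝ E] [FiniteDimensional ℝ E] :
    ContinuousConstSMul (LinearMap.GeneralLinearGroup ℝ E) E :=
  ⟨fun g ↦ (contDiff_generalLinearGroup_smul g).continuous⟩

instance {E : Type*} [NormedAddCommGroup E] [NormedSpace ℝ E] [FiniteDimensional ℝ E]
    (G : Subgroup (LinearMap.GeneralLinearGroup ℝ E)) : ContinuousConstSMul G E :=
  ⟨fun g ↦ continuous_const_smul (g : LinearMap.GeneralLinearGroup ℝ E)⟩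

theorem exists_isStableUnder_subset {n : ℕ} (G : Subgroup (GLn n)) [Finite G]
    (r₀ : EuclideanSpace ℝ (Fin n)) {N : Set (EuclideanSpace ℝ (Fin n))} (hN : N ∈ 𝓝 r₀) :
    ∃ W ⊆ N, r₀ ∈ W ∧ IsOpen W ∧ IsStableUnder G W ∧ setStabilizer G W = isotropy G r₀ := by
  have : Finite (isotropy G r₀) := Finite.Set.subset (G : Set (GLn n)) inf_le_left
  obtain ⟨D, hD, hdisj⟩ := ProperlyDiscontinuousSMul.exists_nhds_disjoint_image G r₀
  obtain ⟨W, hWND, hr₀W, hW, hconv, hinv⟩ :=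
    exists_isOpen_convex_smul_eq (H := isotropy G r₀) (fun g ↦ g.2.2) (Filter.inter_mem hN hD)
  obtain ⟨hWN, hWD⟩ := Set.subset_inter_iff.1 hWND
  have hmove : ∀ g ∈ G, g • r₀ ≠ r₀ → Disjoint (g • W) W := fun g hg hgr₀ ↦
    (hdisj ⟨g, hg⟩ hgr₀).mono (Set.image_mono hWD) hWD
  refine ⟨W, hWN, hr₀W, hW, ⟨⟨⟨r₀, hr₀W⟩, hconv.isPreconnected⟩, fun g hg ↦ ?_⟩,
    le_antisymm (fun g hg ↦ ⟨hg.1, ?_⟩) fun g hg ↦ ⟨hg.1, hinv ⟨g, hg⟩⟩⟩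
  · exact (em (g • r₀ = r₀)).imp (fun hgr₀ ↦ hinv ⟨g, hg, hgr₀⟩) (hmove g hg)
  · by_contra hgr₀
    have hgW : g • W = W := hg.2
    have hdisjW : Disjoint (g • W) W := hmove g hg.1 hgr₀
    rw [hgW] at hdisjW
    exact Set.disjoint_left.1 hdisjW hr₀W hr₀W

end StableNeighborhood

section OrbifoldChart

variable {n : ℕ} {U : Set (EuclideanSpace ℝ (Fin n))} {G : Subgroup (GLn n)}

theorem orbitSetoid_apply {r s : U} :
    orbitSetoid U G r s ↔ ∃ g ∈ G, g • (s : EuclideanSpace ℝ (Fin n)) = r := by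
  change (r : EuclideanSpace ℝ (Fin n)) ∈ MulAction.orbit G (s : EuclideanSpace ℝ (Fin n)) ↔ _
  simp [MulAction.mem_orbit_iff, Subgroup.smul_def]

theorem isLocalSubduction_quotientMk_orbitSetoid (hU : ∀ g ∈ G, ∀ r ∈ U, g • r ∈ U) :
    IsLocalSubduction (Quotient.mk (orbitSetoid U G)) := by
  refine isLocalSubduction_quotientMk fun a b hab ↦ ?_
  obtain ⟨g, hg, hga⟩ := orbitSetoid_apply.1 ((orbitSetoid U G).symm hab)
  refine ⟨fun r ↦ ⟨g • r, hU g hg r r.2⟩, ?_, Subtype.ext hga,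
    fun r ↦ orbitSetoid_apply.2 ⟨g, hg, rfl⟩⟩
  exact dSmooth_codRestrict
    ((contDiff_generalLinearGroup_smul g).dSmooth.comp (dSmooth_subtypeVal U)) _

variable {φ : U → X}

theorem isLocalSubduction_of_isOrbifoldChart (h : IsOrbifoldChart U G φ) : IsLocalSubduction φ := by
  obtain ⟨S, hS, e, he⟩ := h.exists_diffeomorph
  rw [funext he]
  exact (isLocalSubduction_subtypeVal hS).comp ((isLocalSubduction_dDiffeomorph e).comp
    (isLocalSubduction_quotientMk_orbitSetoid h.invariant))

theorem ker_eq_orbitSetoid_of_isOrbifoldChart (h : IsOrbifoldChart U G φ) :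
    Setoid.ker φ = orbitSetoid U G := by
  obtain ⟨S, -, e, he⟩ := h.exists_diffeomorph
  ext r s
  rw [Setoid.ker_def, he, he, SetCoe.ext_iff, e.toEquiv.apply_eq_iff_eq, Quotient.eq]

theorem isOrbifoldChart_of_isLocalSubduction (hU : IsOpen U) (hUconn : IsConnected U)
    (hG : Finite G) (hinv : ∀ g ∈ G, ∀ r ∈ U, g • r ∈ U) (hφ : IsLocalSubduction φ)
    (hker : Setoid.ker φ = orbitSetoid U G) : IsOrbifoldChart U G φ where
  isOpen := hU
  isConnected := hUconn
  finite := hG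
  invariant := hinv
  exists_diffeomorph := by
    rw [← hker]
    exact ⟨Set.range φ, hφ.isDOpen_range, hφ.quotientKerDiffeomorph, fun _ ↦ rfl⟩

end OrbifoldChart

section Lift

variable {n : ℕ} {U : Set (EuclideanSpace ℝ (Fin n))} {G : Subgroup (GLn n)} {φ : U → Y}
  {f : X → Y} {r₀ : U} {ξ : X} {V : Set (EuclideanSpace ℝ (Fin n))} {L : V → X}

theorem eventually_apply_smul_eq_of_isLocalLift (hf : IsDiffEtale f) (hφ : IsOrbifoldChart U G φ)
    (hL : IsLocalLift f φ r₀ ξ V L) {g : GLn n} (hg : g ∈ isotropy G r₀) :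
    ∀ᶠ r in 𝓝 (r₀ : EuclideanSpace ℝ (Fin n)), ∀ (hr : r ∈ V) (hgr : g • r ∈ V),
      L ⟨g • r, hgr⟩ = L ⟨r, hr⟩ := by
  obtain ⟨hr₀V, -⟩ := hL.base
  have hgr₀ : g • (r₀ : EuclideanSpace ℝ (Fin n)) = r₀ := hg.2
  have hV : V ∩ (g • ·) ⁻¹' V ∈ 𝓝 (r₀ : EuclideanSpace ℝ (Fin n)) :=
    (hL.isOpen.inter (hL.isOpen.preimage (continuous_const_smul g))).mem_nhds
      ⟨hr₀V, by rwa [Set.mem_preimage, hgr₀]⟩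
  obtain ⟨ρ, hρ, hρV, hρr₀⟩ := exists_contDiff_eventuallyEq_id hV
  have hgρ : ContDiff ℝ ∞ fun y ↦ g • ρ y := (contDiff_generalLinearGroup_smul g).comp hρ
  have hp : IsPlot fun y ↦ L ⟨ρ y, (hρV y).1⟩ := hL.dSmooth _ _ hρ.isPlot
  have hq : IsPlot fun y ↦ L ⟨g • ρ y, (hρV y).2⟩ := hL.dSmooth _ _ hgρ.isPlot
  have hfqp : ∀ y, f (L ⟨g • ρ y, (hρV y).2⟩) = f (L ⟨ρ y, (hρV y).1⟩) := fun y ↦ by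
    rw [hL.lift, hL.lift, ← Setoid.ker_def, ker_eq_orbitSetoid_of_isOrbifoldChart hφ]
    exact orbitSetoid_apply.2 ⟨g, hg.1, rfl⟩
  have hqp := eventuallyEq_of_isDiffEtale hf hq hp (x := r₀) (.of_forall hfqp)
    (by simp only [hρr₀.eq_of_nhds, id, hgr₀])
  filter_upwards [hqp, hρr₀] with r hr hρr _ _
  simpa only [hρr, id] using hr

theorem isOrbifoldChart_lift (hf : IsDiffEtale f) (hφ : IsOrbifoldChart U G φ)
    (hL : IsLocalLift f φ r₀ ξ V L) {W : Set (EuclideanSpace ℝ (Fin n))} (hWV : W ⊆ V)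
    (hW : IsOpen W) (hstable : IsStableUnder G W)
    (hinv : ∀ g ∈ setStabilizer G W, ∀ r s : W, g • (s : EuclideanSpace ℝ (Fin n)) = r →
      L (Set.inclusion hWV r) = L (Set.inclusion hWV s)) :
    IsOrbifoldChart W (setStabilizer G W) fun r ↦ L (Set.inclusion hWV r) := by
  have hlift : ∀ r : W, f (L (Set.inclusion hWV r)) = φ (Set.inclusion (hWV.trans hL.subset) r) :=
    fun r ↦ hL.lift _
  have hGW : ∀ g ∈ setStabilizer G W, g • W = W := fun g hg ↦ hg.2
  have := hφ.finite
  refine isOrbifoldChart_of_isLocalSubduction hW hstable.1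
    (Finite.Set.subset (G : Set (GLn n)) inf_le_left)
    (fun g hg r hr ↦ hGW g hg ▸ Set.smul_mem_smul_set hr) ?_ ?_
  · refine isLocalSubduction_of_comp hf (hL.dSmooth.comp (dSmooth_inclusion hWV)) ?_
    have hcomp : (f ∘ fun r : W ↦ L (Set.inclusion hWV r)) =
        φ ∘ Set.inclusion (hWV.trans hL.subset) := funext hlift
    rw [hcomp]
    exact (isLocalSubduction_of_isOrbifoldChart hφ).comp (isLocalSubduction_inclusion hW _)
  · ext r s
    rw [Setoid.ker_def, orbitSetoid_apply]
    refine ⟨fun hrs ↦ ?_, fun ⟨g, hg, hgs⟩ ↦ hinv g hg r s hgs⟩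
    have hφrs := (hlift r).symm.trans ((congrArg f hrs).trans (hlift s))
    rw [← Setoid.ker_def, ker_eq_orbitSetoid_of_isOrbifoldChart hφ, orbitSetoid_apply] at hφrs
    obtain ⟨g, hg, hgs⟩ := hφrs
    have hmeet : ¬ Disjoint (g • W) W :=
      Set.not_disjoint_iff.2 ⟨r, ⟨s, s.2, hgs⟩, r.2⟩
    exact ⟨g, ⟨hg, (hstable.2 g hg).resolve_right hmeet⟩, hgs⟩

theorem exists_isOrbifoldChart_of_isLocalLift (hf : IsDiffEtale f) (hφ : IsOrbifoldChart U G φ)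
    (hL : IsLocalLift f φ r₀ ξ V L) :
    ∃ (W : Set (EuclideanSpace ℝ (Fin n))) (hWV : W ⊆ V),
      (r₀ : EuclideanSpace ℝ (Fin n)) ∈ W ∧ IsOpen W ∧ IsStableUnder G W ∧
      setStabilizer G W = isotropy G r₀ ∧
      IsOrbifoldChart W (setStabilizer G W) fun r : W ↦ L (Set.inclusion hWV r) := by
  have := hφ.finite
  have : Finite (isotropy G r₀) := Finite.Set.subset (G : Set (GLn n)) inf_le_left
  obtain ⟨hr₀V, -⟩ := hL.base
  have hinv := Filter.eventually_all.2 fun g : isotropy G r₀ ↦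
    eventually_apply_smul_eq_of_isLocalLift hf hφ hL g.2
  obtain ⟨W, hWN, hr₀W, hW, hstable, hGW⟩ := exists_isStableUnder_subset G r₀
    ((hL.isOpen.eventually_mem hr₀V).and hinv)
  have hWV : W ⊆ V := fun r hr ↦ (hWN hr).1
  refine ⟨W, hWV, hr₀W, hW, hstable, hGW, isOrbifoldChart_lift hf hφ hL hWV hW hstable ?_⟩
  rintro g hg ⟨_, hgs⟩ s rfl
  exact (hWN s.2).2 ⟨g, hGW ▸ hg⟩ (hWV s.2) (hWV hgs)

theorem isDiffOrbifold_of_isDiffEtale (hf : IsDiffEtale f) (hY : IsDiffOrbifold n Y) :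
    IsDiffOrbifold n X := by
  intro ξ
  obtain ⟨U, G, φ, hφ, r₀, hr₀⟩ := hY (f ξ)
  obtain ⟨V, L, hL⟩ :=
    exists_isLocalLift hf hφ.isOpen (isLocalSubduction_of_isOrbifoldChart hφ).dSmooth hr₀
  obtain ⟨W, hWV, hr₀W, -, -, -, hchart⟩ := exists_isOrbifoldChart_of_isLocalLift hf hφ hL
  exact ⟨W, _, _, hchart, ⟨r₀, hr₀W⟩, hL.base.2⟩

end Lift

end EtaleOrbifold

open EtaleOrbifold

theorem theorem5p14 {n : ℕ} {E : Type*} {O : Type*} [DiffeologicalSpace E] [DiffeologicalSpace O]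
    (hO : IsDiffOrbifold n O) :
    (∀ π : E → O, IsDiffEtale π →
      IsDiffOrbifold n E ∧
      ∀ (ξ : E) (U : Set (EuclideanSpace ℝ (Fin n))) (G : Subgroup (GLn n)) (φ : U → O),
        IsOrbifoldChart U G φ → ∀ r₀ : U, φ r₀ = π ξ →
          (∃ (V : Set (EuclideanSpace ℝ (Fin n))) (L : V → E), IsLocalLift π φ r₀ ξ V L) ∧
          ∀ (V : Set (EuclideanSpace ℝ (Fin n))) (L : V → E), IsLocalLift π φ r₀ ξ V L →
            ∃ (W : Set (EuclideanSpace ℝ (Fin n))) (hWV : W ⊆ V),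
              (r₀ : EuclideanSpace ℝ (Fin n)) ∈ W ∧ IsOpen W ∧ IsStableUnder G W ∧
              setStabilizer G W = isotropy G r₀ ∧
              IsOrbifoldChart W (setStabilizer G W) (fun r : W ↦ L (Set.inclusion hWV r))) ∧
    (∀ π : E → O, IsDiffCovering π → IsDiffOrbifold n E) := by
  refine ⟨fun π hπ ↦ ⟨isDiffOrbifold_of_isDiffEtale hπ hO, fun ξ U G φ hφ r₀ hr₀ ↦ ⟨?_, ?_⟩⟩,
    fun π hπ ↦ isDiffOrbifold_of_isDiffEtale (isDiffEtale_of_isDiffCovering hπ) hO⟩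
  · exact exists_isLocalLift hπ hφ.isOpen (isLocalSubduction_of_isOrbifoldChart hφ).dSmooth hr₀
  · exact fun V L hL ↦ exists_isOrbifoldChart_of_isLocalLift hπ hφ hL
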